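/- **Definitions.** A *Hilbert module* over $\mathbb{C}[z_1,\dots,z_n]$ is a complex Hilbert space $\mathcal{H}$ with an $n$-tuple of commuting bounded operators $M_{z_1},\dots,M_{z_n}$ on $\mathcal{H}$. Two Hilbert modules are *isomorphic* ($\cong$) if there is a unitary operator between them that intertwines the operators $M_{z_i}$ for $i=1,\dots,n$. For $w\in\mathbb{C}^n$ put $\ker(M_z-wI)^*=\bigcap_{i=1}^n\ker(M_{z_i}-w_iI)^*$. For a domain (nonempty connected open set) $\Omega\subseteq\mathbb{C}^n$, the class $B_1^*(\Omega)$ consists of the Hilbert modules $\mathcal{H}$ such that (i) for all $w\in\Omega$ the operator $\mathcal{H}\to\mathcal{H}^n$, $h\mapsto\big((M_{z_1}-w_1I)^*h,\dots,(M_{z_n}-w_nI)^*h\big)$, has closed range; (ii) $\dim\ker(M_z-wI)^*=1$ for all $w\in\Omega$; (iii) the closed linear span of $\bigcup_{w\in\Omega}\ker(M_z-wI)^*$ is $\mathcal{H}$. Let $\mathcal{H}\in B_1^*(\Omega)$ and let $p,q\ge 0$ be integers. Write elements of $\mathcal{H}\otimes\mathbb{C}^p$ as $f=(f_1,\dots,f_p)$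 with $f_j\in\mathcal{H}$, and for $k\in\mathcal{H}$ put $f[k]=(\langle f_1,k\rangle,\dots,\langle f_p,k\rangle)\in\mathbb{C}^p$; for $0\neq k\in\ker(M_z-wI)^*$ this is the value of $f$ at $w$ with respect to $k$. A function $\Theta:\Omega\to\mathcal{B}(\mathbb{C}^p,\mathbb{C}^q)$ is a *multiplier* for $\mathcal{H}$, written $\Theta\in\mathcal{M}(\mathcal{H}\otimes\mathbb{C}^p,\mathcal{H}\otimes\mathbb{C}^q)$, if for every $f\in\mathcal{H}\otimes\mathbb{C}^p$ there is $g\in\mathcal{H}\otimes\mathbb{C}^q$ with $g[k]=\Theta(w)f[k]$ for all $w\in\Omega$ and $k\in\ker(M_z-wI)^*$; this $g$ is unique by (iii) and is denoted $M_\Theta f$. The multiplier $\Theta$ has a *left inverse multiplier* for $\mathcal{H}$ if there is $\Psi\in\mathcal{M}(\mathcal{H}\otimes\mathbb{C}^q,\mathcal{H}\otimes\mathbb{C}^p)$ with $\Psi(w)\Theta(w)=I_{\mathbb{C}^p}$ for all $w\in\Omega$. In that case $M_\Theta(\mathcal{H}\otimes\mathbb{C}^p)$ is a closed submodule of $\mathcal{H}\otimes\mathbb{C}^q$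 (on which $z_i$ acts by $M_{z_i}\otimes I$), and $\mathcal{H}_\Theta$ denotes the quotient Hilbert module $(\mathcal{H}\otimes\mathbb{C}^q)/M_\Theta(\mathcal{H}\otimes\mathbb{C}^p)$. **Statement.** Let $\Omega\subseteq\mathbb{C}^n$ be a domain, let $\mathcal{H},\tilde{\mathcal{H}}\in B_1^*(\Omega)$, and let $\Theta_1,\Theta_2:\Omega\to\mathcal{B}(\mathbb{C}^p,\mathbb{C}^q)$ be functions each of which lies in both $\mathcal{M}(\mathcal{H}\otimes\mathbb{C}^p,\mathcal{H}\otimes\mathbb{C}^q)$ and $\mathcal{M}(\tilde{\mathcal{H}}\otimes\mathbb{C}^p,\tilde{\mathcal{H}}\otimes\mathbb{C}^q)$ and has a left inverse multiplier for $\mathcal{H}$ and a left inverse multiplier for $\tilde{\mathcal{H}}$. Then $$\mathcal{H}_{\Theta_1}\cong\mathcal{H}_{\Theta_2}\quad\text{if and only if}\quad\tilde{\mathcal{H}}_{\Theta_1}\cong\tilde{\mathcal{H}}_{\Theta_2}.$$ -/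

import Mathlib

noncomputable section

/-- A Hilbert module over `ℂ[z₁, …, zₙ]`: a complex Hilbert space `H` with an `n`-tuple of
commuting bounded operators `M_{z₁}, …, M_{zₙ}`, a polynomial `p` acting as
`p (M_{z₁}, …, M_{zₙ})`. -/
structure HilbertModule (n : ℕ) (H : Type*) [NormedAddCommGroup H] [InnerProductSpace ℂ H]
    [CompleteSpace H] where
  /-- the operator of module multiplication by the `i`-th coordinate function -/
  coord : Fin n → H →L[ℂ] H
  commute : ∀ i j, Commute (coord i) (coord j)

/-- Two tuples of operators define isomorphic modules: there is a unitary operator (a surjective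
linear isometry) that intertwines them. -/
def IsUnitarilyIsomorphic {n : ℕ} {E F : Type*}
    [SeminormedAddCommGroup E] [NormedSpace ℂ E] [SeminormedAddCommGroup F] [NormedSpace ℂ F]
    (S : Fin n → E →L[ℂ] E) (T : Fin n → F →L[ℂ] F) : Prop :=
  ∃ U : E ≃ₗᵢ[ℂ] F, ∀ (i : Fin n) (x : E), U (S i x) = T i (U x)

/-- `H ⊗ ℂ^q`, realized as the Hilbert space direct sum of `q` copies of `H`. -/
abbrev HilbertTensor (H : Type*) (q : ℕ) : Type _ := PiLp 2 (fun _ : Fin q => H)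

namespace HilbertModule

variable {n : ℕ} {H : Type*} [NormedAddCommGroup H] [InnerProductSpace ℂ H] [CompleteSpace H]

/-- The operator `(M_{zᵢ} - wᵢ I)^*`. -/
def shiftAdjoint (M : HilbertModule n H) (w : Fin n → ℂ) (i : Fin n) : H →L[ℂ] H :=
  ContinuousLinearMap.adjoint (M.coord i - w i • ContinuousLinearMap.id ℂ H)

/-- The joint eigenspace `ker (M_z - w I)^* = ⋂ᵢ ker (M_{zᵢ} - wᵢ I)^*`. -/
def fiber (M : HilbertModule n H) (w : Fin n → ℂ) : Submodule ℂ H :=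
  ⨅ i : Fin n, (M.shiftAdjoint w i).ker

/-- Membership of a Hilbert module in the class `B_m^*(Ω)`. -/
structure IsInBStar (M : HilbertModule n H) (m : ℕ) (Ω : Set (Fin n → ℂ)) : Prop where
  /-- the column operator `h ↦ ((M_{zᵢ} - wᵢ I)^* h)ᵢ` from `H` to `Hⁿ` has closed range -/
  isClosed_range : ∀ w ∈ Ω, IsClosed (Set.range
    (fun h : H => (WithLp.toLp 2 (fun i => M.shiftAdjoint w i h) : HilbertTensor H n)))
  rank_fiber : ∀ w ∈ Ω, Module.rank ℂ (M.fiber w) = m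
  span_fiber : (⨆ w ∈ Ω, M.fiber w).topologicalClosure = ⊤

/-- The value at `k` of a vector `f = (f₁, …, f_p)` of `H ⊗ ℂ^p`: the vector of `ℂ^p` with
components `⟨f_j, k⟩` (linear in `f_j`; Mathlib's inner product is linear in its second
argument). When `k = K(·, w)` is the kernel function of `H` at `w`, this is `f(w)`. -/
def eval {p : ℕ} (k : H) (f : HilbertTensor H p) : EuclideanSpace ℂ (Fin p) :=
  WithLp.toLp 2 (fun j => inner ℂ k (f j))

/-- The relation `g = Θ f`, that is `g(w) = Θ(w) f(w)` for all `w ∈ Ω`. The value of a vector at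
`w` is read off against every vector `k` of the eigenspace at `w`; for a one-dimensional
eigenspace with a chosen kernel function `K(·, w)` this is equality of the values at `w`, and it
does not depend on the choice of the kernel function. -/
def IsProduct (M : HilbertModule n H) {Ω : Set (Fin n → ℂ)} {p q : ℕ}
    (Θ : Ω → EuclideanSpace ℂ (Fin p) →L[ℂ] EuclideanSpace ℂ (Fin q))
    (f : HilbertTensor H p) (g : HilbertTensor H q) : Prop :=
  ∀ w : Ω, ∀ k ∈ M.fiber w, eval k g = Θ w (eval k f)

/-- `Θ` is a multiplier from `H ⊗ ℂ^p` to `H ⊗ ℂ^q`: for every `f` in `H ⊗ ℂ^p` the pointwise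
product `Θ f` belongs to `H ⊗ ℂ^q`. -/
def IsMultiplier (M : HilbertModule n H) {Ω : Set (Fin n → ℂ)} {p q : ℕ}
    (Θ : Ω → EuclideanSpace ℂ (Fin p) →L[ℂ] EuclideanSpace ℂ (Fin q)) : Prop :=
  ∀ f : HilbertTensor H p, ∃ g : HilbertTensor H q, M.IsProduct Θ f g

/-- `Θ` has a left inverse that is itself a multiplier from `H ⊗ ℂ^q` to `H ⊗ ℂ^p`. -/
def HasLeftInverseMultiplier (M : HilbertModule n H) {Ω : Set (Fin n → ℂ)} {p q : ℕ}
    (Θ : Ω → EuclideanSpace ℂ (Fin p) →L[ℂ] EuclideanSpace ℂ (Fin q)) : Prop :=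
  ∃ Ψ : Ω → EuclideanSpace ℂ (Fin q) →L[ℂ] EuclideanSpace ℂ (Fin p),
    M.IsMultiplier Ψ ∧ ∀ w : Ω, Ψ w ∘L Θ w = ContinuousLinearMap.id ℂ _

set_option linter.unusedSectionVars false in
theorem eval_add {p : ℕ} (k : H) (f g : HilbertTensor H p) :
    eval k (f + g) = eval k f + eval k g := by
  ext j; simp [eval]

set_option linter.unusedSectionVars false in
theorem eval_smul {p : ℕ} (k : H) (c : ℂ) (f : HilbertTensor H p) :
    eval k (c • f) = c • eval k f := by
  ext j; simp [eval]

set_option linter.unusedSectionVars false in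
theorem eval_zero {p : ℕ} (k : H) : eval k (0 : HilbertTensor H p) = 0 := by
  ext j; simp [eval]

/-- The submodule `M_Θ (H ⊗ ℂ^p)` of `H ⊗ ℂ^q`. -/
def multRange (M : HilbertModule n H) {Ω : Set (Fin n → ℂ)} {p q : ℕ}
    (Θ : Ω → EuclideanSpace ℂ (Fin p) →L[ℂ] EuclideanSpace ℂ (Fin q)) :
    Submodule ℂ (HilbertTensor H q) where
  carrier := {g | ∃ f : HilbertTensor H p, M.IsProduct Θ f g}
  zero_mem' := ⟨0, fun w k _ => by simp [eval_zero]⟩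
  add_mem' := by
    rintro g₁ g₂ ⟨f₁, h₁⟩ ⟨f₂, h₂⟩
    exact ⟨f₁ + f₂, fun w k hk => by
      rw [eval_add, eval_add, map_add, h₁ w k hk, h₂ w k hk]⟩
  smul_mem' := by
    rintro c g ⟨f, h⟩
    exact ⟨c • f, fun w k hk => by rw [eval_smul, eval_smul, map_smul, h w k hk]⟩

/-- The module action of `zᵢ` on `H ⊗ ℂ^q`, that is `M_{zᵢ} ⊗ I`. -/
def tensorCoord (M : HilbertModule n H) (q : ℕ) (i : Fin n) :
    HilbertTensor H q →L[ℂ] HilbertTensor H q :=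
  (PiLp.continuousLinearEquiv 2 ℂ (fun _ : Fin q => H)).symm.toContinuousLinearMap ∘L
    ContinuousLinearMap.piMap (fun _ : Fin q => M.coord i) ∘L
      (PiLp.continuousLinearEquiv 2 ℂ (fun _ : Fin q => H)).toContinuousLinearMap

@[simp]
theorem tensorCoord_apply (M : HilbertModule n H) (q : ℕ) (i : Fin n)
    (x : HilbertTensor H q) (j : Fin q) : M.tensorCoord q i x j = M.coord i (x j) := rfl

theorem inner_coord_of_mem_fiber (M : HilbertModule n H) {w : Fin n → ℂ} {k : H}
    (hk : k ∈ M.fiber w) (i : Fin n) (x : H) :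
    inner ℂ k (M.coord i x) = w i * inner ℂ k x := by
  have h0 : M.shiftAdjoint w i k = 0 := by
    have := (Submodule.mem_iInf _).1 hk i
    simpa using this
  have h1 : inner ℂ (M.shiftAdjoint w i k) x = 0 := by rw [h0, inner_zero_left]
  rw [shiftAdjoint, ContinuousLinearMap.adjoint_inner_left] at h1
  simpa [inner_sub_right, inner_smul_right, sub_eq_zero] using h1

theorem eval_tensorCoord (M : HilbertModule n H) {w : Fin n → ℂ} {k : H}
    (hk : k ∈ M.fiber w) {p : ℕ} (i : Fin n) (f : HilbertTensor H p) :
    eval k (M.tensorCoord p i f) = w i • eval k f := by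
  ext j
  simp [eval, M.inner_coord_of_mem_fiber hk]

/-- `M_Θ (H ⊗ ℂ^p)` is invariant under the module action. -/
theorem tensorCoord_mem_multRange (M : HilbertModule n H) {Ω : Set (Fin n → ℂ)} {p q : ℕ}
    (Θ : Ω → EuclideanSpace ℂ (Fin p) →L[ℂ] EuclideanSpace ℂ (Fin q)) (i : Fin n)
    {g : HilbertTensor H q} (hg : g ∈ M.multRange Θ) :
    M.tensorCoord q i g ∈ M.multRange Θ := by
  obtain ⟨f, hf⟩ := hg
  exact ⟨M.tensorCoord p i f, fun w k hk => by
    rw [M.eval_tensorCoord hk, M.eval_tensorCoord hk, map_smul, hf w k hk]⟩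

/-- The space of the quotient module `H_Θ = (H ⊗ ℂ^q) / M_Θ (H ⊗ ℂ^p)`, with the quotient norm,
in which `H_Θ` is isometric to the orthogonal complement of `M_Θ (H ⊗ ℂ^p)` as soon as that
range is closed (which holds when the multiplier `Θ` has a left inverse multiplier). -/
abbrev QuotModule (M : HilbertModule n H) {Ω : Set (Fin n → ℂ)} {p q : ℕ}
    (Θ : Ω → EuclideanSpace ℂ (Fin p) →L[ℂ] EuclideanSpace ℂ (Fin q)) : Type _ :=
  HilbertTensor H q ⧸ M.multRange Θ

/-- The module action of `zᵢ` on the quotient module `H_Θ`, induced from `H ⊗ ℂ^q`. -/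
def quotCoord (M : HilbertModule n H) {Ω : Set (Fin n → ℂ)} {p q : ℕ}
    (Θ : Ω → EuclideanSpace ℂ (Fin p) →L[ℂ] EuclideanSpace ℂ (Fin q)) (i : Fin n) :
    M.QuotModule Θ →L[ℂ] M.QuotModule Θ where
  toLinearMap := (M.multRange Θ).mapQ (M.multRange Θ) (M.tensorCoord q i).toLinearMap
    (fun _ hg => M.tensorCoord_mem_multRange Θ i hg)
  cont := by
    refine (M.multRange Θ).isQuotientMap_mkQ.continuous_iff.2 ?_
    exact (M.multRange Θ).isQuotientMap_mkQ.continuous.comp (M.tensorCoord q i).continuous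

end HilbertModule

end

open Filter Topology

/-! Isomorphism of the quotients is equivalent to `AreKernelEquivalent Θ₁ Θ₂`, a condition in which
the Hilbert module does not occur. Applying this equivalence to both modules gives the theorem.

Write `k` for an eigenvector at `w`. Because `Θ` has a left inverse multiplier, the vectors `k ⊗ x`
with `x ⊥ ran Θ(w)` are total in the orthogonal complement of the range of `M_Θ`
(`mem_multRange_iff`). Their Gram matrix is `⟨k, k'⟩⟨x, x'⟩`. Hence maps between the fibers that
preserve all inner products, also between different points, induce a unitary, and it intertwines
because the `k ⊗ x` are joint eigenvectors.

Conversely, a unitary intertwiner preserves joint eigenvectors, and eigenspaces of `H` are lines, so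
it sends `k ⊗ x` to `k ⊗ u(w)x` (`exists_eq_elemTensor`). Unitarity yields `⟨k, k'⟩⟨u(w)x, u(v)y⟩ =
⟨k, k'⟩⟨x, y⟩`, which can be cancelled only where `⟨k, k'⟩ ≠ 0`, in particular for `w` near `v`. The
identity theorem on the connected set `Ω` carries the equality to all `w`. It rests on
antiholomorphic local eigenvectors (`exists_local_section`) and on a section of the fibers through
the given `x` (`exists_section_orthogonal_range`). -/

/-! ### Hilbert space preliminaries -/

theorem denseRange_linearCombination_of_inner_eq_zero {ι E : Type*}
    [NormedAddCommGroup E] [InnerProductSpace ℂ E] [CompleteSpace E]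
    (c : ι → E) (hc : ∀ z, (∀ i, inner ℂ (c i) z = 0) → z = 0) :
    DenseRange (Finsupp.linearCombination ℂ c) := by
  have h : (LinearMap.range (Finsupp.linearCombination ℂ c)).topologicalClosure = ⊤ := by
    rw [Submodule.topologicalClosure_eq_top_iff, Submodule.eq_bot_iff]
    exact fun z hz => hc z fun i =>
      (Submodule.mem_orthogonal _ _).1 hz (c i) ⟨Finsupp.single i 1, by simp⟩
  rw [← Submodule.dense_iff_topologicalClosure_eq_top] at h
  exact h

/-- Two total families of vectors with the same Gram matrix are related by a unitary operator. -/
theorem exists_linearIsometryEquiv_of_inner_eq {ι E F : Type*}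
    [NormedAddCommGroup E] [InnerProductSpace ℂ E] [CompleteSpace E]
    [NormedAddCommGroup F] [InnerProductSpace ℂ F] [CompleteSpace F]
    (a : ι → E) (b : ι → F) (hab : ∀ i j, inner ℂ (a i) (a j) = inner ℂ (b i) (b j))
    (ha : ∀ z, (∀ i, inner ℂ (a i) z = 0) → z = 0)
    (hb : ∀ z, (∀ i, inner ℂ (b i) z = 0) → z = 0) :
    ∃ U : E ≃ₗᵢ[ℂ] F, ∀ i, U (a i) = b i := by
  have norm_eq (l : ι →₀ ℂ) :
      ‖Finsupp.linearCombination ℂ b l‖ = ‖Finsupp.linearCombination ℂ a l‖ := by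
    rw [@norm_eq_sqrt_re_inner ℂ, @norm_eq_sqrt_re_inner ℂ]
    simp only [Finsupp.linearCombination_apply, Finsupp.sum, sum_inner, inner_sum,
      inner_smul_left, inner_smul_right, hab]
  have da := denseRange_linearCombination_of_inner_eq_zero a ha
  have db := denseRange_linearCombination_of_inner_eq_zero b hb
  refine ⟨(LinearEquiv.refl ℂ (ι →₀ ℂ)).extendOfIsometry _ _ da db norm_eq, fun i => ?_⟩
  simpa using (LinearEquiv.refl ℂ (ι →₀ ℂ)).extendOfIsometry_eq _ _ da db norm_eq
    (Finsupp.single i 1)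

/-- A bounded operator with closed range is left invertible modulo the projection onto its
kernel. -/
theorem exists_comp_eq_sub_starProjection_ker {E F : Type*}
    [NormedAddCommGroup E] [InnerProductSpace ℂ E] [CompleteSpace E]
    [NormedAddCommGroup F] [InnerProductSpace ℂ F] [CompleteSpace F]
    (D : E →L[ℂ] F) (hD : IsClosed (Set.range D)) :
    ∃ L : F →L[ℂ] E, ∀ h, ∃ k ∈ D.ker, L (D h) = h - k := by
  have : CompleteSpace D.ker := D.isClosed_ker.completeSpace_coe
  set D' : D.kerᗮ →L[ℂ] F := D ∘L D.kerᗮ.subtypeL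
  have proj (h : E) : D (h - D.ker.starProjection h) = D h := by
    have : D.ker.starProjection h ∈ D.ker := Submodule.starProjection_apply_mem _ _
    have : D (D.ker.starProjection h) = 0 := this
    rw [map_sub, this, sub_zero]
  have hrange : Set.range D' = Set.range D := by
    apply le_antisymm
    · rintro _ ⟨x, rfl⟩
      exact ⟨x, rfl⟩
    · rintro _ ⟨h, rfl⟩
      exact ⟨⟨h - D.ker.starProjection h, Submodule.sub_starProjection_mem_orthogonal h⟩, proj h⟩
  -- On the complement of its kernel `D` is injective with the same closed range, hence has a
  -- bounded left inverse.
  have hinj : Function.Injective D' := by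
    rw [injective_iff_map_eq_zero]
    intro x hx
    have : (x : E) ∈ D.ker := hx
    exact Subtype.ext (Submodule.disjoint_def.1 D.ker.orthogonal_disjoint x this x.2)
  have hcl : IsClosed (D'.range : Set F) := by
    have : (D'.range : Set F) = Set.range D' := by ext; simp
    rw [this, hrange]; exact hD
  have : CompleteSpace D'.range := hcl.completeSpace_coe
  obtain ⟨L, hL⟩ := ContinuousLinearMap.HasLeftInverse.of_injective_of_isClosed_range_of_closedComplement_range
    hinj (hrange ▸ hD) ⟨D'.range.orthogonalProjectionOnto, fun x => by simp⟩
  refine ⟨D.kerᗮ.subtypeL ∘L L, fun h => ⟨D.ker.starProjection h,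
    Submodule.starProjection_apply_mem _ _, ?_⟩⟩
  have := hL ⟨h - D.ker.starProjection h, Submodule.sub_starProjection_mem_orthogonal h⟩
  rw [← proj h]
  exact congrArg Subtype.val this

/-! ### Antiholomorphic local eigenvectors -/

namespace HilbertModule

variable {n : ℕ} {H : Type*} [NormedAddCommGroup H] [InnerProductSpace ℂ H] [CompleteSpace H]

theorem shiftAdjoint_apply (M : HilbertModule n H) (w : Fin n → ℂ) (i : Fin n) (h : H) :
    M.shiftAdjoint w i h =
      ContinuousLinearMap.adjoint (M.coord i) h - starRingEnd ℂ (w i) • h := by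
  refine ext_inner_right ℂ fun x => ?_
  rw [shiftAdjoint, ContinuousLinearMap.adjoint_inner_left]
  simp [inner_sub_left, inner_sub_right, inner_smul_left, inner_smul_right,
    ContinuousLinearMap.adjoint_inner_left]

theorem mem_fiber_iff (M : HilbertModule n H) {w : Fin n → ℂ} {k : H} :
    k ∈ M.fiber w ↔ ∀ i, M.shiftAdjoint w i k = 0 := by
  simp [fiber, Submodule.mem_iInf]

theorem mem_fiber_of_inner (M : HilbertModule n H) {w : Fin n → ℂ} {k : H}
    (hk : ∀ i x, inner ℂ k (M.coord i x) = w i * inner ℂ k x) : k ∈ M.fiber w := by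
  refine M.mem_fiber_iff.2 fun i => ext_inner_right ℂ fun x => ?_
  rw [shiftAdjoint, ContinuousLinearMap.adjoint_inner_left]
  simp [inner_sub_right, inner_smul_right, hk]

theorem IsInBStar.exists_generator {M : HilbertModule n H} {Ω : Set (Fin n → ℂ)}
    (hM : M.IsInBStar 1 Ω) {w : Fin n → ℂ} (hw : w ∈ Ω) :
    ∃ k ∈ M.fiber w, k ≠ 0 ∧ ∀ k' ∈ M.fiber w, ∃ c : ℂ, k' = c • k := by
  have h := hM.rank_fiber w hw
  rw [Nat.cast_one, rank_eq_one_iff] at h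
  obtain ⟨k, hk0, hk⟩ := h
  refine ⟨k, k.2, by simpa using hk0, fun k' hk' => ?_⟩
  obtain ⟨c, hc⟩ := hk ⟨k', hk'⟩
  exact ⟨c, (congrArg Subtype.val hc).symm⟩

/-- Near every point of `Ω` the eigenspaces are spanned by an antiholomorphic section. -/
theorem IsInBStar.exists_local_section {M : HilbertModule n H} {Ω : Set (Fin n → ℂ)}
    (hM : M.IsInBStar 1 Ω) {w₀ : Fin n → ℂ} (hw₀ : w₀ ∈ Ω) :
    ∃ k : (Fin n → ℂ) → H, (∀ᶠ w in 𝓝 w₀, w ∈ Ω → k w ∈ M.fiber w) ∧ k w₀ ≠ 0 ∧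
      ∀ f : H, AnalyticAt ℂ (fun w => inner ℂ (k w) f) w₀ := by
  obtain ⟨k₀, hk₀, hk₀', hgen⟩ := hM.exists_generator hw₀
  let D : H →L[ℂ] HilbertTensor H n :=
    (PiLp.continuousLinearEquiv 2 ℂ (fun _ : Fin n => H)).symm.toContinuousLinearMap ∘L
      ContinuousLinearMap.pi (fun i => M.shiftAdjoint w₀ i)
  have hDapp (h : H) : D h = WithLp.toLp 2 (fun i => M.shiftAdjoint w₀ i h) := rfl
  obtain ⟨L, hL⟩ := exists_comp_eq_sub_starProjection_ker D (hM.isClosed_range w₀ hw₀)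
  have hker {k : H} (hk : k ∈ D.ker) : k ∈ M.fiber w₀ := by
    refine M.mem_fiber_iff.2 fun i => ?_
    have : D k = 0 := hk
    exact congrArg (fun z : HilbertTensor H n => z i) this
  let A (i : Fin n) : H →L[ℂ] H := L ∘L
    (PiLp.continuousLinearEquiv 2 ℂ (fun _ : Fin n => H)).symm.toContinuousLinearMap ∘L
      ContinuousLinearMap.single ℂ (fun _ : Fin n => H) i
  have hA (v : Fin n → H) : L (WithLp.toLp 2 v) = ∑ i, A i (v i) := by
    have : (WithLp.toLp 2 v : HilbertTensor H n) =
        ∑ i, (PiLp.continuousLinearEquiv 2 ℂ (fun _ : Fin n => H)).symm (Pi.single i (v i)) := by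
      rw [← map_sum, Finset.univ_sum_single]; rfl
    rw [this, map_sum]; rfl
  -- On the eigenspace at `w` the operator `D` acts as `k ↦ (conj (wᵢ - w₀ᵢ) k)ᵢ`, so there `S w`
  -- agrees with `1 - L D`, which takes values in the line `ker D`. Its adjoint `T w` is analytic in
  -- `w` and equals `1` at `w₀`.
  let S (w : Fin n → ℂ) : H →L[ℂ] H := 1 - ∑ i, starRingEnd ℂ (w i - w₀ i) • A i
  let T (w : Fin n → ℂ) : H →L[ℂ] H :=
    1 - ∑ i, (w i - w₀ i) • ContinuousLinearMap.adjoint (A i)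
  have hTS (w) : star (T w) = S w := by
    simp only [T, S, star_sub, star_one, star_sum, star_smul,
      ContinuousLinearMap.star_eq_adjoint, ContinuousLinearMap.adjoint_adjoint,
      map_sub, starRingEnd_apply]
  have hT₀ : T w₀ = 1 := by simp [T]
  have hT : AnalyticAt ℂ T w₀ := by
    refine analyticAt_const.sub (Finset.analyticAt_fun_sum _ fun i _ => ?_)
    refine AnalyticAt.fun_smul ?_ analyticAt_const
    exact ((ContinuousLinearMap.proj (R := ℂ) (φ := fun _ : Fin n => ℂ) i).analyticAt w₀).sub
      analyticAt_const
  have hB : AnalyticAt ℂ (fun w => Ring.inverse (T w)) w₀ := by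
    have := analyticAt_inverse (𝕜 := ℂ) (1 : (H →L[ℂ] H)ˣ)
    rw [Units.val_one, ← hT₀] at this
    exact this.comp hT
  have hunit : ∀ᶠ w in 𝓝 w₀, IsUnit (T w) := by
    refine hT.continuousAt.eventually_mem (Units.isOpen.mem_nhds ?_)
    change IsUnit (T w₀)
    rw [hT₀]; exact isUnit_one
  refine ⟨fun w => star (Ring.inverse (T w)) k₀, ?_, ?_, fun f => ?_⟩
  · filter_upwards [hunit] with w hw hwΩ
    obtain ⟨k, hk, hk0, -⟩ := hM.exists_generator hwΩ
    have hSk : ∃ c : ℂ, S w k = c • k₀ := by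
      obtain ⟨k₁, hk₁, h₁⟩ := hL k
      obtain ⟨c, rfl⟩ := hgen _ (hker hk₁)
      refine ⟨c, ?_⟩
      have h₂ : ∀ i, M.shiftAdjoint w₀ i k = starRingEnd ℂ (w i - w₀ i) • k := fun i => by
        have := M.mem_fiber_iff.1 hk i
        rw [shiftAdjoint_apply] at this ⊢
        rw [sub_eq_zero.1 this, map_sub, sub_smul]
      rw [hDapp, hA] at h₁
      simp only [h₂, map_smul] at h₁
      simp only [S, sub_apply, one_apply_eq_self,
        sum_apply, smul_apply, h₁, sub_sub_cancel]
    obtain ⟨c, hc⟩ := hSk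
    -- `S w` is invertible near `w₀`, so the eigenvector `k` at `w` is a multiple of `(S w)⁻¹ k₀`.
    -- Since `k ≠ 0`, the latter is itself an eigenvector.
    have hk' : k = c • star (Ring.inverse (T w)) k₀ := by
      rw [← map_smul, ← hc, ← hTS, ← mul_apply_eq_comp, ← star_mul,
        Ring.mul_inverse_cancel _ hw, star_one, one_apply_eq_self]
    have hc0 : c ≠ 0 := by
      rintro rfl
      exact hk0 (by simpa using hk')
    have : star (Ring.inverse (T w)) k₀ = c⁻¹ • k := by
      rw [hk', smul_smul, inv_mul_cancel₀ hc0, one_smul]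
    rw [this]
    exact Submodule.smul_mem _ _ hk
  · simpa [hT₀] using hk₀'
  · have : (fun w => inner ℂ (star (Ring.inverse (T w)) k₀) f) =
        fun w => (innerSL ℂ k₀) (ContinuousLinearMap.apply ℂ H f (Ring.inverse (T w))) := by
      funext w
      rw [ContinuousLinearMap.star_eq_adjoint, ContinuousLinearMap.adjoint_inner_left]
      rfl
    rw [this]
    exact ((innerSL ℂ k₀).analyticAt _).comp
      (((ContinuousLinearMap.apply ℂ H f).analyticAt _).comp hB)

end HilbertModule

/-! ### Identity theorem; quotients as orthogonal complements -/

/-- Identity theorem for functions that are locally quotients of analytic functions with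
nonvanishing denominators, on a preconnected open set. -/
theorem eq_zero_of_locally_analytic_quotient {E : Type*} [NormedAddCommGroup E] [NormedSpace ℂ E]
    {Ω : Set E} (hΩ : IsOpen Ω) (hc : IsPreconnected Ω) (g : Ω → ℂ)
    (hg : ∀ w₀ : Ω, ∃ φ ψ : E → ℂ, AnalyticAt ℂ φ w₀ ∧ AnalyticAt ℂ ψ w₀ ∧ ψ w₀ ≠ 0 ∧
      ∀ᶠ w in 𝓝 (w₀ : E), ∀ h : w ∈ Ω, ψ w * g ⟨w, h⟩ = φ w)
    (v : Ω) (hv : ∀ᶠ w in 𝓝 (v : E), ∀ h : w ∈ Ω, g ⟨w, h⟩ = 0) (w : Ω) : g w = 0 := by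
  classical
  let G : E → ℂ := fun w => if h : w ∈ Ω then g ⟨w, h⟩ else 0
  have hG : AnalyticOnNhd ℂ G Ω := fun w₀ hw₀ => by
    obtain ⟨φ, ψ, hφ, hψ, h0, he⟩ := hg ⟨w₀, hw₀⟩
    refine (hφ.fun_div hψ h0).congr ?_
    filter_upwards [he, hΩ.mem_nhds hw₀, hψ.continuousAt.eventually_ne h0] with w h₁ h₂ h₃
    simp only [G, h₂, dif_pos]
    rw [← h₁ h₂, mul_div_cancel_left₀ _ h₃]
  have h0 : G =ᶠ[𝓝 (v : E)] 0 := by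
    filter_upwards [hv, hΩ.mem_nhds v.2] with w h₁ h₂
    simpa [G, h₂] using h₁ h₂
  simpa [G] using hG.eqOn_zero_of_preconnected_of_eventuallyEq_zero hc v.2 h0 w.2

theorem Submodule.inner_eq_inner_quotientEquivOrthogonal {E : Type*} [NormedAddCommGroup E]
    [InnerProductSpace ℂ E] (R : Submodule ℂ E) [R.HasOrthogonalProjection] (e : Rᗮ) (f : E) :
    inner ℂ (e : E) f = inner ℂ e (R.quotientEquivOrthogonal (R.mkQ f)) := by
  have h₁ : f - (f - R.starProjection f) ∈ R := by
    rw [sub_sub_cancel]; exact Submodule.starProjection_apply_mem _ _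
  have h₂ : R.mkQ f = R.mkQ (f - R.starProjection f) :=
    (Submodule.Quotient.eq R).2 h₁
  rw [h₂, Submodule.mkQ_apply,
    R.quotientEquivOrthogonal_mk _ (Submodule.sub_starProjection_mem_orthogonal f),
    Submodule.coe_inner, inner_sub_right,
    (Submodule.mem_orthogonal' _ _).1 e.2 _ (Submodule.starProjection_apply_mem _ _), sub_zero]

/-- A unitary operator between quotients, transferred to the orthogonal complements. -/
theorem exists_orthogonal_equiv_of_quotient_equiv {E : Type*} [NormedAddCommGroup E]
    [InnerProductSpace ℂ E] (R₁ R₂ : Submodule ℂ E)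
    [R₁.HasOrthogonalProjection] [R₂.HasOrthogonalProjection] (U : (E ⧸ R₁) ≃ₗᵢ[ℂ] (E ⧸ R₂)) :
    ∃ W : R₁ᗮ ≃ₗᵢ[ℂ] R₂ᗮ, ∀ (e : R₁ᗮ) (f f' : E), U (R₁.mkQ f') = R₂.mkQ f →
      inner ℂ (W e : E) f = inner ℂ (e : E) f' := by
  refine ⟨(R₁.quotientEquivOrthogonal.symm.trans U).trans R₂.quotientEquivOrthogonal,
    fun e f f' h => ?_⟩
  set W := (R₁.quotientEquivOrthogonal.symm.trans U).trans R₂.quotientEquivOrthogonal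
  rw [Submodule.inner_eq_inner_quotientEquivOrthogonal, Submodule.inner_eq_inner_quotientEquivOrthogonal,
    ← h, ← W.inner_map_map e]
  congr 1
  exact congrArg (fun z => R₂.quotientEquivOrthogonal (U z))
    (R₁.quotientEquivOrthogonal.symm_apply_apply (R₁.mkQ f')).symm

/-! ### Kernel equivalence and elementary tensors -/

/-- The fibers `(ran Θ₁(w))ᗮ` and `(ran Θ₂(w))ᗮ` correspond under maps which preserve all inner
products, also those between different fibers. -/
def AreKernelEquivalent {X : Type*} {p q : ℕ}
    (Θ₁ Θ₂ : X → EuclideanSpace ℂ (Fin p) →L[ℂ] EuclideanSpace ℂ (Fin q)) : Prop :=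
  ∃ u : X → EuclideanSpace ℂ (Fin q) → EuclideanSpace ℂ (Fin q),
    (∀ w, ∀ x ∈ (Θ₁ w).rangeᗮ, u w x ∈ (Θ₂ w).rangeᗮ) ∧
    (∀ w, ∀ y ∈ (Θ₂ w).rangeᗮ, ∃ x ∈ (Θ₁ w).rangeᗮ, u w x = y) ∧
    ∀ w v, ∀ x ∈ (Θ₁ w).rangeᗮ, ∀ y ∈ (Θ₁ v).rangeᗮ, inner ℂ (u w x) (u v y) = inner ℂ x y

/-- The elementary tensor `k ⊗ x`. -/
def elemTensor {H : Type*} [NormedAddCommGroup H] [InnerProductSpace ℂ H] {q : ℕ} (k : H)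
    (x : EuclideanSpace ℂ (Fin q)) : HilbertTensor H q :=
  WithLp.toLp 2 fun j => x j • k

namespace HilbertModule

variable {n : ℕ} {H : Type*} [NormedAddCommGroup H] [InnerProductSpace ℂ H] [CompleteSpace H]

set_option linter.unusedSectionVars false in
theorem inner_elemTensor_left {q : ℕ} (k : H) (x : EuclideanSpace ℂ (Fin q))
    (f : HilbertTensor H q) : inner ℂ (elemTensor k x) f = inner ℂ x (eval k f) := by
  simp [elemTensor, eval, PiLp.inner_apply, inner_smul_left, mul_comm]

set_option linter.unusedSectionVars false in
theorem eval_elemTensor {q : ℕ} (k k' : H) (x : EuclideanSpace ℂ (Fin q)) :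
    eval k (elemTensor k' x) = (inner ℂ k k' : ℂ) • x := by
  ext j; simp [eval, elemTensor, mul_comm]

set_option linter.unusedSectionVars false in
theorem inner_elemTensor_elemTensor {q : ℕ} (k k' : H) (x x' : EuclideanSpace ℂ (Fin q)) :
    inner ℂ (elemTensor k x) (elemTensor k' x') = (inner ℂ k k' : ℂ) * inner ℂ x x' := by
  rw [inner_elemTensor_left, eval_elemTensor, inner_smul_right]

variable {Ω : Set (Fin n → ℂ)} {p q : ℕ}
  {Θ : Ω → EuclideanSpace ℂ (Fin p) →L[ℂ] EuclideanSpace ℂ (Fin q)}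

theorem inner_elemTensor_of_mem_multRange (M : HilbertModule n H) {w : Ω} {k : H}
    (hk : k ∈ M.fiber w) {x : EuclideanSpace ℂ (Fin q)} (hx : x ∈ (Θ w).rangeᗮ)
    {g : HilbertTensor H q} (hg : g ∈ M.multRange Θ) : inner ℂ (elemTensor k x) g = 0 := by
  obtain ⟨f, hf⟩ := hg
  rw [inner_elemTensor_left, hf w k hk]
  exact (Submodule.mem_orthogonal' _ _).1 hx _ ⟨_, rfl⟩

theorem elemTensor_mem_orthogonal (M : HilbertModule n H) {w : Ω} {k : H} (hk : k ∈ M.fiber w)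
    {x : EuclideanSpace ℂ (Fin q)} (hx : x ∈ (Θ w).rangeᗮ) :
    elemTensor k x ∈ (M.multRange Θ)ᗮ :=
  (Submodule.mem_orthogonal' _ _).2 fun _ hg => M.inner_elemTensor_of_mem_multRange hk hx hg

/-- The range of a left invertible multiplier is the annihilator of the joint eigenvectors
`k ⊗ x` with `x` orthogonal to `ran Θ(w)`. -/
theorem mem_multRange_iff (M : HilbertModule n H) (hΨ : M.HasLeftInverseMultiplier Θ)
    {g : HilbertTensor H q} : g ∈ M.multRange Θ ↔
      ∀ (w : Ω), ∀ k ∈ M.fiber w, ∀ x ∈ (Θ w).rangeᗮ, inner ℂ (elemTensor k x) g = 0 := by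
  refine ⟨fun hg w k hk x hx => M.inner_elemTensor_of_mem_multRange hk hx hg, fun hg => ?_⟩
  obtain ⟨Ψ, hΨm, hΨΘ⟩ := hΨ
  -- The preimage is `f = M_Ψ g`: pointwise `g(w) = Θ(w)c`, so `ΘΨg = ΘΨΘc = Θc = g` at `w`.
  obtain ⟨f, hf⟩ := hΨm g
  refine ⟨f, fun w k hk => ?_⟩
  have hmem : eval k g ∈ (Θ w).range := by
    rw [← Submodule.orthogonal_orthogonal (Θ w).range]
    refine (Submodule.mem_orthogonal _ _).2 fun x hx => ?_
    rw [← inner_elemTensor_left]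
    exact hg w k hk x hx
  obtain ⟨c, hc⟩ := hmem
  rw [hf w k hk, ← hc]
  exact (congrArg (fun A => Θ w (A c)) (hΨΘ w)).symm

theorem isClosed_multRange (M : HilbertModule n H) (hΨ : M.HasLeftInverseMultiplier Θ) :
    IsClosed (M.multRange Θ : Set (HilbertTensor H q)) := by
  have : (M.multRange Θ : Set (HilbertTensor H q)) =
      ⋂ (w : Ω) (k ∈ M.fiber w) (x ∈ (Θ w).rangeᗮ), {g | inner ℂ (elemTensor k x) g = 0} := by
    ext g
    simp only [SetLike.mem_coe, M.mem_multRange_iff hΨ, Set.mem_iInter, Set.mem_ofPred_eq]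
  rw [this]
  exact isClosed_iInter fun w => isClosed_biInter fun k _ => isClosed_biInter fun x _ =>
    isClosed_eq (by fun_prop) continuous_const

theorem hasOrthogonalProjection_multRange (M : HilbertModule n H)
    (hΨ : M.HasLeftInverseMultiplier Θ) : (M.multRange Θ).HasOrthogonalProjection := by
  have := (M.isClosed_multRange hΨ).completeSpace_coe
  exact Submodule.HasOrthogonalProjection.ofCompleteSpace _

/-- Totality of the `k ⊗ x` in the complement, in the form needed for comparing Gram matrices. -/
theorem eq_zero_of_inner_elemTensor (M : HilbertModule n H) (hΨ : M.HasLeftInverseMultiplier Θ)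
    {z : HilbertTensor H q} (hz : z ∈ (M.multRange Θ)ᗮ)
    (h : ∀ (w : Ω), ∀ k ∈ M.fiber w, ∀ x ∈ (Θ w).rangeᗮ, inner ℂ (elemTensor k x) z = 0) :
    z = 0 :=
  Submodule.disjoint_def.1 (Submodule.orthogonal_disjoint (M.multRange Θ)) z
    ((M.mem_multRange_iff hΨ).2 h) hz

/-- Pairing `k ⊗ x` with `M_Θ (k ⊗ c)` gives `‖k‖² ⟨x, Θ(w)c⟩`. -/
theorem mem_orthogonal_of_elemTensor_mem (M : HilbertModule n H) (hΘ : M.IsMultiplier Θ)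
    {w : Ω} {k : H} (hk : k ∈ M.fiber w) (hk0 : k ≠ 0)
    {x : EuclideanSpace ℂ (Fin q)} (hx : elemTensor k x ∈ (M.multRange Θ)ᗮ) :
    x ∈ (Θ w).rangeᗮ := by
  refine (Submodule.mem_orthogonal' _ _).2 ?_
  rintro _ ⟨c, rfl⟩
  obtain ⟨g, hg⟩ := hΘ (elemTensor k c)
  have h := (Submodule.mem_orthogonal' _ _).1 hx g ⟨_, hg⟩
  rw [inner_elemTensor_left, hg w k hk, eval_elemTensor, map_smul, inner_smul_right] at h
  exact (mul_eq_zero.1 h).resolve_left (inner_self_ne_zero.2 hk0)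

theorem inner_elemTensor_tensorCoord (M : HilbertModule n H) {w : Fin n → ℂ} {k : H}
    (hk : k ∈ M.fiber w) (x : EuclideanSpace ℂ (Fin q)) (i : Fin n) (f : HilbertTensor H q) :
    inner ℂ (elemTensor k x) (M.tensorCoord q i f) = w i * inner ℂ (elemTensor k x) f := by
  rw [inner_elemTensor_left, M.eval_tensorCoord hk, inner_smul_right, inner_elemTensor_left]

end HilbertModule

theorem elemTensor_smul_left {H : Type*} [NormedAddCommGroup H] [InnerProductSpace ℂ H] {q : ℕ}
    (c : ℂ) (k : H) (x : EuclideanSpace ℂ (Fin q)) :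
    elemTensor (c • k) x = c • elemTensor k x := by
  ext j; exact smul_comm _ _ _

theorem elemTensor_injective {H : Type*} [NormedAddCommGroup H] [InnerProductSpace ℂ H] {q : ℕ}
    {k : H} (hk : k ≠ 0) :
    Function.Injective (elemTensor k : EuclideanSpace ℂ (Fin q) → HilbertTensor H q) := by
  intro x y h
  ext j
  exact smul_left_injective ℂ hk (congrArg (fun z : HilbertTensor H q => z j) h)

/-! ### Joint eigenvectors, and isomorphism from kernel equivalence -/

namespace HilbertModule

variable {n : ℕ} {H : Type*} [NormedAddCommGroup H] [InnerProductSpace ℂ H] [CompleteSpace H]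
  {Ω : Set (Fin n → ℂ)} {p q : ℕ}
  {Θ₁ Θ₂ : Ω → EuclideanSpace ℂ (Fin p) →L[ℂ] EuclideanSpace ℂ (Fin q)}

theorem quotCoord_mkQ (M : HilbertModule n H)
    (Θ : Ω → EuclideanSpace ℂ (Fin p) →L[ℂ] EuclideanSpace ℂ (Fin q)) (i : Fin n)
    (f : HilbertTensor H q) :
    M.quotCoord Θ i ((M.multRange Θ).mkQ f) = (M.multRange Θ).mkQ (M.tensorCoord q i f) := rfl

/-- Testing the eigenvector relation on vectors supported in the `j`-th summand isolates the
component `g j`. -/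
theorem mem_fiber_of_inner_tensorCoord (M : HilbertModule n H) {w : Fin n → ℂ}
    {g : HilbertTensor H q}
    (hg : ∀ i f, inner ℂ g (M.tensorCoord q i f) = w i * inner ℂ g f) (j : Fin q) :
    g j ∈ M.fiber w := by
  refine M.mem_fiber_of_inner fun i a => ?_
  have h (b : H) : inner ℂ g (WithLp.toLp 2 (Pi.single j b) : HilbertTensor H q) =
      inner ℂ (g j) b := by
    rw [PiLp.inner_apply, Finset.sum_eq_single j]
    · simp
    · intro l _ hl
      simp [Pi.single_eq_of_ne hl]
    · simp
  have hT : M.tensorCoord q i (WithLp.toLp 2 (Pi.single j a)) =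
      WithLp.toLp 2 (Pi.single j (M.coord i a)) := by
    ext l
    rw [tensorCoord_apply]
    exact Pi.apply_single (fun _ => M.coord i) (fun _ => map_zero _) j a l
  rw [← h, ← h, ← hT, hg]

/-- The dual of an isomorphism of quotient modules maps `k ⊗ x` to a vector `k ⊗ y`. -/
theorem exists_eq_elemTensor (M : HilbertModule n H) (hΘ₂ : M.IsMultiplier Θ₂)
    {w : Ω} {k : H} (hk : k ∈ M.fiber w) (hk0 : k ≠ 0)
    (hgen : ∀ k' ∈ M.fiber w, ∃ c : ℂ, k' = c • k)
    (U : M.QuotModule Θ₁ ≃ₗᵢ[ℂ] M.QuotModule Θ₂)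
    (hU : ∀ i x, U (M.quotCoord Θ₁ i x) = M.quotCoord Θ₂ i (U x))
    (x : EuclideanSpace ℂ (Fin q)) (g : HilbertTensor H q) (hg : g ∈ (M.multRange Θ₂)ᗮ)
    (hpair : ∀ f f', U ((M.multRange Θ₁).mkQ f') = (M.multRange Θ₂).mkQ f →
      inner ℂ g f = inner ℂ (elemTensor k x) f') :
    ∃ y ∈ (Θ₂ w).rangeᗮ, g = elemTensor k y := by
  have hmem : ∀ j, g j ∈ M.fiber w := by
    refine M.mem_fiber_of_inner_tensorCoord fun i f => ?_
    obtain ⟨f', hf'⟩ := (M.multRange Θ₁).mkQ_surjective (U.symm ((M.multRange Θ₂).mkQ f))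
    have hf : U ((M.multRange Θ₁).mkQ f') = (M.multRange Θ₂).mkQ f := by
      rw [hf', U.apply_symm_apply]
    rw [hpair f f' hf, hpair (M.tensorCoord q i f) (M.tensorCoord q i f'),
      M.inner_elemTensor_tensorCoord hk]
    rw [← quotCoord_mkQ, ← quotCoord_mkQ, hU, hf]
  choose y hy using fun j => hgen _ (hmem j)
  have hgy : g = elemTensor k (WithLp.toLp 2 y) := by
    ext j; exact hy j
  exact ⟨_, M.mem_orthogonal_of_elemTensor_mem hΘ₂ hk hk0 (hgy ▸ hg), hgy⟩

theorem inner_quotientEquivOrthogonal_quotCoord (M : HilbertModule n H)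
    {Θ : Ω → EuclideanSpace ℂ (Fin p) →L[ℂ] EuclideanSpace ℂ (Fin q)}
    [(M.multRange Θ).HasOrthogonalProjection] {w : Ω} {k : H} (hk : k ∈ M.fiber w)
    {x : EuclideanSpace ℂ (Fin q)} {e : (M.multRange Θ)ᗮ}
    (he : (e : HilbertTensor H q) = elemTensor k x) (i : Fin n) (z : M.QuotModule Θ) :
    inner ℂ e ((M.multRange Θ).quotientEquivOrthogonal (M.quotCoord Θ i z)) =
      (w : Fin n → ℂ) i * inner ℂ e ((M.multRange Θ).quotientEquivOrthogonal z) := by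
  obtain ⟨f, rfl⟩ := (M.multRange Θ).mkQ_surjective z
  rw [quotCoord_mkQ, ← Submodule.inner_eq_inner_quotientEquivOrthogonal,
    ← Submodule.inner_eq_inner_quotientEquivOrthogonal, he, M.inner_elemTensor_tensorCoord hk]

theorem isUnitarilyIsomorphic_of_areKernelEquivalent (M : HilbertModule n H)
    (hΨ₁ : M.HasLeftInverseMultiplier Θ₁) (hΨ₂ : M.HasLeftInverseMultiplier Θ₂)
    (h : AreKernelEquivalent Θ₁ Θ₂) :
    IsUnitarilyIsomorphic (M.quotCoord Θ₁) (M.quotCoord Θ₂) := by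
  obtain ⟨u, hu, hsurj, hin⟩ := h
  have := M.hasOrthogonalProjection_multRange hΨ₁
  have := M.hasOrthogonalProjection_multRange hΨ₂
  let ι := {t : Ω × H × EuclideanSpace ℂ (Fin q) //
    t.2.1 ∈ M.fiber t.1 ∧ t.2.2 ∈ (Θ₁ t.1).rangeᗮ}
  let a (t : ι) : (M.multRange Θ₁)ᗮ :=
    ⟨elemTensor t.1.2.1 t.1.2.2, M.elemTensor_mem_orthogonal t.2.1 t.2.2⟩
  let b (t : ι) : (M.multRange Θ₂)ᗮ :=
    ⟨elemTensor t.1.2.1 (u t.1.1 t.1.2.2), M.elemTensor_mem_orthogonal t.2.1 (hu _ _ t.2.2)⟩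
  have hb : ∀ z, (∀ t, inner ℂ (b t) z = 0) → z = 0 := fun z hz =>
    Subtype.ext <| M.eq_zero_of_inner_elemTensor hΨ₂ z.2 fun w k hk y hy => by
      obtain ⟨x, hx, rfl⟩ := hsurj w y hy
      exact hz ⟨(w, k, x), hk, hx⟩
  obtain ⟨W, hW⟩ := exists_linearIsometryEquiv_of_inner_eq a b
    (fun s t => by
      simp only [Submodule.coe_inner, a, b, inner_elemTensor_elemTensor,
        hin _ _ _ s.2.2 _ t.2.2])
    (fun z hz => Subtype.ext <| M.eq_zero_of_inner_elemTensor hΨ₁ z.2 fun w k hk x hx =>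
      hz ⟨(w, k, x), hk, hx⟩) hb
  set J₁ := (M.multRange Θ₁).quotientEquivOrthogonal
  set J₂ := (M.multRange Θ₂).quotientEquivOrthogonal
  refine ⟨(J₁.trans W).trans J₂.symm, fun i x => ?_⟩
  apply J₂.injective
  rw [LinearIsometryEquiv.trans_apply, J₂.apply_symm_apply, LinearIsometryEquiv.trans_apply,
    ← sub_eq_zero]
  -- Intertwining is tested on the total family `b`: as `a t` and `b t` are joint eigenvectors at
  -- the same point `w`, both sides pair with `b t` to `wᵢ` times the same number.
  refine hb _ fun t => ?_
  have hWt (z) : inner ℂ (b t) (W z) = inner ℂ (a t) z := by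
    rw [← hW, W.inner_map_map]
  rw [inner_sub_right, LinearIsometryEquiv.trans_apply, LinearIsometryEquiv.trans_apply, hWt,
    M.inner_quotientEquivOrthogonal_quotCoord t.2.1 rfl,
    M.inner_quotientEquivOrthogonal_quotCoord t.2.1 rfl, J₂.apply_symm_apply, hWt, sub_self]

end HilbertModule

/-! ### Kernel equivalence from isomorphism -/

namespace HilbertModule

variable {n : ℕ} {H : Type*} [NormedAddCommGroup H] [InnerProductSpace ℂ H] [CompleteSpace H]
  {Ω : Set (Fin n → ℂ)} {p q : ℕ}
  {Θ Θ₁ Θ₂ : Ω → EuclideanSpace ℂ (Fin p) →L[ℂ] EuclideanSpace ℂ (Fin q)}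

/-- A left inverse multiplier yields, for every `a`, a section `P` of the bundle with fibers
`(ran Θ(w))ᗮ` which takes the value `a` wherever `a` belongs to the fiber, and for which
`k ⊗ P(w)` represents the same functional as `k ⊗ a` up to a fixed change of the argument. -/
theorem exists_section_orthogonal_range (M : HilbertModule n H) (hΘ : M.IsMultiplier Θ)
    (hΨ : M.HasLeftInverseMultiplier Θ) (a : EuclideanSpace ℂ (Fin q)) :
    ∃ P : Ω → EuclideanSpace ℂ (Fin q), (∀ w, P w ∈ (Θ w).rangeᗮ) ∧
      (∀ w, a ∈ (Θ w).rangeᗮ → P w = a) ∧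
      ∀ f : HilbertTensor H q, ∃ h : HilbertTensor H q, ∀ w : Ω, ∀ k ∈ M.fiber w,
        inner ℂ (elemTensor k (P w)) f = inner ℂ a (eval k h) := by
  obtain ⟨Ψ, hΨm, hΨΘ⟩ := hΨ
  -- `Θ(w)Ψ(w)` is an idempotent with range `ran Θ(w)`, so `1 - (ΘΨ)^*` is an idempotent onto the
  -- orthogonal complement of that range. Moving it to the other side replaces `f` by `f - M_Θ M_Ψ
  -- f`, which does not depend on `w`.
  let P (w : Ω) : EuclideanSpace ℂ (Fin q) := a - ContinuousLinearMap.adjoint (Θ w ∘L Ψ w) a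
  have hP (w : Ω) (y) : inner ℂ (P w) y = (inner ℂ a y : ℂ) - inner ℂ a (Θ w (Ψ w y)) := by
    simp only [P, inner_sub_left, ContinuousLinearMap.adjoint_inner_left]
    rfl
  refine ⟨P, fun w => ?_, fun w ha => ext_inner_right ℂ fun y => ?_, fun f => ?_⟩
  · refine (Submodule.mem_orthogonal' _ _).2 ?_
    rintro _ ⟨c, rfl⟩
    have h : Ψ w (Θ w c) = c := congrArg (fun A => A c) (hΨΘ w)
    change inner ℂ (P w) (Θ w c) = 0
    rw [hP, h, sub_self]
  · have h : inner ℂ a (Θ w (Ψ w y)) = (0 : ℂ) :=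
      (Submodule.mem_orthogonal' _ _).1 ha _ ⟨_, rfl⟩
    rw [hP, h, sub_zero]
  · obtain ⟨f₁, hf₁⟩ := hΨm f
    obtain ⟨f₂, hf₂⟩ := hΘ f₁
    refine ⟨f + (-1 : ℂ) • f₂, fun w k hk => ?_⟩
    rw [inner_elemTensor_left, hP, ← hf₁ w k hk, ← hf₂ w k hk, eval_add, eval_smul, inner_add_right,
      inner_smul_right, neg_one_mul, sub_eq_add_neg]

set_option linter.unusedSectionVars false in
theorem analyticAt_inner_eval {k : (Fin n → ℂ) → H} {w₀ : Fin n → ℂ}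
    (hk : ∀ f : H, AnalyticAt ℂ (fun w => inner ℂ (k w) f) w₀)
    (a : EuclideanSpace ℂ (Fin q)) (f : HilbertTensor H q) :
    AnalyticAt ℂ (fun w => inner ℂ a (eval (k w) f)) w₀ := by
  simp only [eval, PiLp.inner_apply, RCLike.inner_apply]
  exact Finset.analyticAt_fun_sum _ fun j _ => (hk (f j)).mul analyticAt_const

theorem areKernelEquivalent_of_isUnitarilyIsomorphic (M : HilbertModule n H)
    (hΩ : IsOpen Ω) (hΩc : IsPreconnected Ω) (hM : M.IsInBStar 1 Ω)
    (hΘ₁ : M.IsMultiplier Θ₁) (hΘ₂ : M.IsMultiplier Θ₂)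
    (hΨ₁ : M.HasLeftInverseMultiplier Θ₁) (hΨ₂ : M.HasLeftInverseMultiplier Θ₂)
    (h : IsUnitarilyIsomorphic (M.quotCoord Θ₁) (M.quotCoord Θ₂)) :
    AreKernelEquivalent Θ₁ Θ₂ := by
  obtain ⟨U, hU⟩ := h
  have := M.hasOrthogonalProjection_multRange hΨ₁
  have := M.hasOrthogonalProjection_multRange hΨ₂
  obtain ⟨W, hW⟩ := exists_orthogonal_equiv_of_quotient_equiv _ _ U
  have hU' (i x) : U.symm (M.quotCoord Θ₂ i x) = M.quotCoord Θ₁ i (U.symm x) := by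
    rw [U.symm_apply_eq, hU, U.apply_symm_apply]
  have hW' (e : (M.multRange Θ₂)ᗮ) (f f' : HilbertTensor H q)
      (hf : U.symm ((M.multRange Θ₂).mkQ f') = (M.multRange Θ₁).mkQ f) :
      inner ℂ (W.symm e : HilbertTensor H q) f = inner ℂ (e : HilbertTensor H q) f' := by
    have := hW (W.symm e) f' f (by rw [← hf, U.apply_symm_apply])
    rw [← this, W.apply_symm_apply]
  choose κ hκ hκ0 hgen using fun w : Ω => hM.exists_generator w.2
  -- The vector `y` is found with the generator `κ w`, but serves every `k` in the eigenspace, since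
  -- all are multiples of `κ w`. Off the fiber the value `0` is a dummy.
  have hex (w : Ω) (x : EuclideanSpace ℂ (Fin q)) : ∃ y, x ∈ (Θ₁ w).rangeᗮ →
      y ∈ (Θ₂ w).rangeᗮ ∧ ∀ e : (M.multRange Θ₁)ᗮ, ∀ k ∈ M.fiber w,
        (e : HilbertTensor H q) = elemTensor k x →
          (W e : HilbertTensor H q) = elemTensor k y := by
    by_cases hx : x ∈ (Θ₁ w).rangeᗮ
    · obtain ⟨y, hy, hy'⟩ := M.exists_eq_elemTensor hΘ₂ (hκ w) (hκ0 w) (hgen w) U hU x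
        (W ⟨_, M.elemTensor_mem_orthogonal (hκ w) hx⟩) (Subtype.prop _) (hW _)
      refine ⟨y, fun _ => ⟨hy, fun e k hk he => ?_⟩⟩
      obtain ⟨c, rfl⟩ := hgen w k hk
      have : e = c • ⟨_, M.elemTensor_mem_orthogonal (hκ w) hx⟩ := by
        ext1
        rw [he, elemTensor_smul_left]; rfl
      rw [this, map_smul, Submodule.coe_smul, hy', elemTensor_smul_left]
    · exact ⟨0, fun h => absurd h hx⟩
  choose u hu using hex
  refine ⟨u, fun w x hx => (hu w x hx).1, fun w y hy => ?_, fun w v x hx y hy => ?_⟩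
  · obtain ⟨x, hx, hx'⟩ := M.exists_eq_elemTensor hΘ₁ (hκ w) (hκ0 w) (hgen w) U.symm hU' y
      (W.symm ⟨_, M.elemTensor_mem_orthogonal (hκ w) hy⟩) (Subtype.prop _) (hW' _)
    refine ⟨x, hx, elemTensor_injective (hκ0 w) ?_⟩
    rw [← (hu w x hx).2 _ _ (hκ w) hx', W.apply_symm_apply]
  · obtain ⟨P, hP, hPx, hPf⟩ := M.exists_section_orthogonal_range hΘ₁ hΨ₁ x
    let E {w : Ω} {k : H} (hk : k ∈ M.fiber w) {z : EuclideanSpace ℂ (Fin q)}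
        (hz : z ∈ (Θ₁ w).rangeᗮ) : (M.multRange Θ₁)ᗮ :=
      ⟨elemTensor k z, M.elemTensor_mem_orthogonal hk hz⟩
    have hWE {w : Ω} {k : H} (hk : k ∈ M.fiber w) {z : EuclideanSpace ℂ (Fin q)}
        (hz : z ∈ (Θ₁ w).rangeᗮ) :
        (W (E hk hz) : HilbertTensor H q) = elemTensor k (u w z) := (hu w z hz).2 _ _ hk rfl
    -- With `v` and `y` fixed, `x` is replaced by the moving vector `P w`, which equals `x` at the
    -- target point.
    have key := eq_zero_of_locally_analytic_quotient hΩ hΩc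
      (fun w => (inner ℂ (u w (P w)) (u v y) : ℂ) - inner ℂ (P w) y) ?_ v ?_ w
    · simp only [hPx w hx] at key
      exact sub_eq_zero.1 key
    · intro w₀
      obtain ⟨k, hk, hk0, hka⟩ := hM.exists_local_section w₀.2
      obtain ⟨f', hf'⟩ := (M.multRange Θ₁).mkQ_surjective
        (U.symm ((M.multRange Θ₂).mkQ (elemTensor (k w₀) (u v y))))
      obtain ⟨h₁, hh₁⟩ := hPf f'
      obtain ⟨h₂, hh₂⟩ := hPf (elemTensor (k w₀) y)
      -- After multiplication by `⟨k w, k w₀⟩` both terms become pairings of `k w ⊗ P w` with the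
      -- fixed vectors `f'` and `k w₀ ⊗ y`; the first uses that `W` is dual to `U`. Such pairings
      -- are analytic in `w`.
      refine ⟨_, _, (analyticAt_inner_eval hka x h₁).sub (analyticAt_inner_eval hka x h₂),
        hka (k w₀), inner_self_ne_zero.2 hk0, ?_⟩
      filter_upwards [hk] with w hw hwΩ
      have hkw := hw hwΩ
      rw [mul_sub, ← inner_elemTensor_elemTensor, ← inner_elemTensor_elemTensor, Pi.sub_apply,
        ← hh₁ ⟨w, hwΩ⟩ _ hkw, ← hh₂ ⟨w, hwΩ⟩ _ hkw, ← hWE (w := ⟨w, hwΩ⟩) hkw (hP _),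
        hW _ _ f' (by rw [hf', U.apply_symm_apply])]
    · obtain ⟨k, hk, hk0, hka⟩ := hM.exists_local_section v.2
      -- Near `v` the factor `⟨k w, k v⟩` does not vanish, so unitarity of `W` can be divided by it.
      filter_upwards [hk, (hka (k v)).continuousAt.eventually_ne (inner_self_ne_zero.2 hk0)]
        with w hw hne hwΩ
      refine (mul_eq_zero.1 ?_).resolve_left hne
      have hkw := hw hwΩ
      have hkv := hk.self_of_nhds v.2
      rw [mul_sub, ← inner_elemTensor_elemTensor, ← inner_elemTensor_elemTensor,
        ← hWE (w := ⟨w, hwΩ⟩) hkw (hP _), ← hWE hkv hy, ← Submodule.coe_inner,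
        W.inner_map_map, sub_eq_zero]
      rfl

theorem isUnitarilyIsomorphic_iff_areKernelEquivalent (M : HilbertModule n H)
    (hΩ : IsOpen Ω) (hΩc : IsPreconnected Ω) (hM : M.IsInBStar 1 Ω)
    (hΘ₁ : M.IsMultiplier Θ₁) (hΘ₂ : M.IsMultiplier Θ₂)
    (hΨ₁ : M.HasLeftInverseMultiplier Θ₁) (hΨ₂ : M.HasLeftInverseMultiplier Θ₂) :
    IsUnitarilyIsomorphic (M.quotCoord Θ₁) (M.quotCoord Θ₂) ↔ AreKernelEquivalent Θ₁ Θ₂ :=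
  ⟨M.areKernelEquivalent_of_isUnitarilyIsomorphic hΩ hΩc hM hΘ₁ hΘ₂ hΨ₁ hΨ₂,
    M.isUnitarilyIsomorphic_of_areKernelEquivalent hΨ₁ hΨ₂⟩

end HilbertModule

theorem corollary3p4 {n p q : ℕ} {H H' : Type*}
    [NormedAddCommGroup H] [InnerProductSpace ℂ H] [CompleteSpace H]
    [NormedAddCommGroup H'] [InnerProductSpace ℂ H'] [CompleteSpace H']
    (Ω : Set (Fin n → ℂ)) (hΩ_open : IsOpen Ω) (hΩ_conn : IsConnected Ω)
    (M : HilbertModule n H) (M' : HilbertModule n H')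
    (hM : M.IsInBStar 1 Ω) (hM' : M'.IsInBStar 1 Ω)
    (Θ₁ Θ₂ : Ω → EuclideanSpace ℂ (Fin p) →L[ℂ] EuclideanSpace ℂ (Fin q))
    (hΘ₁ : M.IsMultiplier Θ₁) (hΘ₂ : M.IsMultiplier Θ₂)
    (hΘ₁' : M'.IsMultiplier Θ₁) (hΘ₂' : M'.IsMultiplier Θ₂)
    (hΨ₁ : M.HasLeftInverseMultiplier Θ₁) (hΨ₂ : M.HasLeftInverseMultiplier Θ₂)
    (hΨ₁' : M'.HasLeftInverseMultiplier Θ₁) (hΨ₂' : M'.HasLeftInverseMultiplier Θ₂) :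
    IsUnitarilyIsomorphic (M.quotCoord Θ₁) (M.quotCoord Θ₂) ↔
      IsUnitarilyIsomorphic (M'.quotCoord Θ₁) (M'.quotCoord Θ₂) := by
  rw [M.isUnitarilyIsomorphic_iff_areKernelEquivalent hΩ_open hΩ_conn.isPreconnected hM hΘ₁ hΘ₂
      hΨ₁ hΨ₂,
    M'.isUnitarilyIsomorphic_iff_areKernelEquivalent hΩ_open hΩ_conn.isPreconnected hM' hΘ₁' hΘ₂'
      hΨ₁' hΨ₂']
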